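/- Conventions. For a metric space $(X,d)$ with $d\le 1$ let $\overline X=X\sqcup X^{-1}\sqcup\{e\}$ with the obvious involution ($(x^{-1})^{-1}=x$, $e^{-1}=e$), and extend $d$ to $\overline X$ by $d(x^{-1},y^{-1})=d(x,y)$, $d(x^{-1},y)=d(x,e)=d(x^{-1},e)=1$ for $x,y\in X$ (so also $d(x,y^{-1})=1$, and $d(e,e)=0$). A *scale* on $\overline X$ is a function $\Gamma:\overline X\times[0,\infty)\to[0,\infty)$ such that for all $x\in\overline X$ and $r\ge 0$: $\Gamma(e,r)=r$ and $\Gamma(x,r)\ge r$; $\Gamma(x,r)=0$ iff $r=0$; $\Gamma(x,\cdot)$ is monotone increasing; $\lim_{r\to 0}\Gamma(x,r)=0$. A *match* on $\{m,\dots,n\}$ is an involution $\theta$ of $\{m,\dots,n\}$ with no $i<j<\theta(i)<\theta(j)$. For a word $w$ of length $l+1$ over $\overline X$ and a match $\theta$ on $\{0,\dots,l\}$ define $N^\theta_\Gamma(w)$ recursively: $N^\theta_\Gamma(x)=d(e,x)$ for a word of one letter; if $l>0$ and $\theta(0)=k<l$, write $w=w_1w_2$ with $|w_1|=k+1$ and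 put $N^\theta_\Gamma(w)=N^{\theta_1}_\Gamma(w_1)+N^{\theta_2}_\Gamma(w_2)$; if $l>0$ and $\theta(0)=l$, write $w=x^{-1}w_1y$ and put $N^\theta_\Gamma(w)=d(x,y)+\max\{\Gamma(x,N^{\theta_1}_\Gamma(w_1)),\Gamma(y,N^{\theta_1}_\Gamma(w_1))\}$, where $\theta_1,\theta_2$ are the (re-indexed) restrictions of $\theta$ and the empty word has value $0$. For $u,v$ in the free group $F(X)$ let $N_\Gamma(u)=\inf N^\theta_\Gamma(w)$ over all nonempty words $w$ over $\overline X$ representing $u$ and all matches $\theta$, let $\delta_\Gamma(u,v)=N_\Gamma(u^{-1}v)$ and $d_\Gamma(u,v)=\delta_\Gamma(u,v)+\delta_\Gamma(u^{-1},v^{-1})$. Let $\overline F_\Gamma(X)$ be the completion of $(F(X),d_\Gamma)$; the group operations of $F(X)$ extend continuously to it and make it a topological group. Let $\mathcal N=\omega^\omega$ be the Baire space with $d(x,y)=\max\{2^{-n}:x(n)\ne y(n)\}$ for $x\neq y$. For $n\in\mathbb N$ let $\mathcal N_n=\{x\in\mathcal N: x(m)=0\text{ for all }m\ge n\}$, and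 let $\pi_n:\mathcal N\to\mathcal N_n$ be given by $\pi_n(x)(m)=x(m)$ if $m<n$ and $\pi_n(x)(m)=0$ if $m\ge n$; put $\pi_n(x^{-1})=\pi_n(x)^{-1}$ and $\pi_n(e)=e$. A scale $\Gamma$ on $\overline{\mathcal N}$ is *regular* if $\Gamma(x,r)\ge\Gamma(\pi_n(x),r)$ for all $x\in\overline{\mathcal N}$, $r\ge 0$, $n\in\mathbb N$. The free group $F(\mathcal N_n)$ carries the topology inherited from $\overline F_\Gamma(\mathcal N)$ via the homomorphism induced by $\mathcal N_n\subseteq\mathcal N$. **Theorem.** Let $\Gamma$ be a regular scale on $\overline{\mathcal N}$ such that $\Gamma(x,\cdot)$ is continuous for every $x\in\overline{\mathcal N}$. Then every $F(\mathcal N_n)$ is discrete, and there are continuous surjective group homomorphisms $f_n:\overline F_\Gamma(\mathcal N)\to F(\mathcal N_n)$, $n\in\mathbb N$, extending $\pi_n$ (that is, $f_n(x)=\pi_n(x)$ for $x\in\mathcal N$), such that $g\mapsto(f_n(g))_{n\in\mathbb N}$ is a continuous injective group homomorphism $\overline F_\Gamma(\mathcal N)\to\prod_{n\in\mathbb N}F(\mathcal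 N_n)$, where the product has the product topology. -/

import Mathlib

open scoped NNReal Topology
open Filter

namespace GraevScale

/-- The alphabet `X ∪ X⁻¹ ∪ {e}`. -/
inductive Letter (X : Type*) : Type _ where
  | e : Letter X
  | pos (x : X) : Letter X
  | neg (x : X) : Letter X

namespace Letter

variable {X Y : Type*}

/-- The formal inverse on the alphabet. -/
def inv : Letter X → Letter X
  | e => e
  | pos x => neg x
  | neg x => pos x

/-- The value of a letter in the free group. -/
def val : Letter X → FreeGroup X
  | e => 1
  | pos x => FreeGroup.of x
  | neg x => (FreeGroup.of x)⁻¹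

/-- The extension of a map `X → Y` to the alphabets. -/
def map (f : X → Y) : Letter X → Letter Y
  | e => e
  | pos x => pos (f x)
  | neg x => neg (f x)

/-- The extension of the metric of `X` to the alphabet (used when the metric of `X` is `≤ 1`). -/
noncomputable def d [MetricSpace X] : Letter X → Letter X → ℝ≥0
  | e, e => 0
  | pos x, pos y => nndist x y
  | neg x, neg y => nndist x y
  | _, _ => 1

theorem inv_inv (a : Letter X) : a.inv.inv = a := by cases a <;> rfl

theorem val_inv (a : Letter X) : a.inv.val = a.val⁻¹ := by cases a <;> simp [inv, val]

theorem d_comm [MetricSpace X] (a b : Letter X) : d a b = d b a := by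
  cases a <;> cases b <;> simp [d, nndist_comm]

theorem d_inv [MetricSpace X] (a b : Letter X) : d a.inv b.inv = d a b := by
  cases a <;> cases b <;> simp [d, inv]

theorem d_self [MetricSpace X] (a : Letter X) : d a a = 0 := by
  cases a <;> simp [d]

end Letter

/-- A scale on the alphabet of `X`. -/
structure Scale (X : Type*) where
  /-- The underlying function. -/
  toFun : Letter X → ℝ≥0 → ℝ≥0
  map_e : ∀ r, toFun Letter.e r = r
  le_map : ∀ x r, r ≤ toFun x r
  map_eq_zero_iff : ∀ x r, toFun x r = 0 ↔ r = 0
  mono : ∀ x, Monotone (toFun x)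
  tendsto_zero : ∀ x, Tendsto (toFun x) (𝓝[>] 0) (𝓝 0)

/-- The value in the free group of a word over the alphabet; two words have the same value exactly
when they have the same reduced word. -/
def wordVal {X : Type*} (w : List (Letter X)) : FreeGroup X := (w.map Letter.val).prod

theorem wordVal_append {X : Type*} (u v : List (Letter X)) : wordVal (u ++ v) = wordVal u * wordVal v := by
  simp [wordVal]

theorem wordVal_cons {X : Type*} (x : Letter X) (v : List (Letter X)) :
    wordVal (x :: v) = x.val * wordVal v := by
  simp [wordVal]

theorem exists_wordVal {X : Type*} (u : FreeGroup X) : ∃ w : List (Letter X), wordVal w = u := by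
  induction u using FreeGroup.induction_on with
  | C1 => exact ⟨[], rfl⟩
  | of x => exact ⟨[.pos x], by simp [wordVal, Letter.val]⟩
  | inv_of x _ => exact ⟨[.neg x], by simp [wordVal, Letter.val]⟩
  | mul a b ha hb =>
    obtain ⟨v, rfl⟩ := ha
    obtain ⟨w, rfl⟩ := hb
    exact ⟨v ++ w, wordVal_append v w⟩

theorem wordVal_inv {X : Type*} (w : List (Letter X)) :
    wordVal (w.map Letter.inv).reverse = (wordVal w)⁻¹ := by
  induction w with
  | nil => rfl
  | cons a t ih =>
    rw [List.map_cons, List.reverse_cons, wordVal_append, ih, wordVal_cons]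
    simp [wordVal, Letter.val_inv]

/-- `θ` restricts to a match on the interval `{m, …, n - 1}`: a non-crossing involution of it
(the values of `θ` elsewhere are irrelevant). -/
structure IsMatch (m n : ℕ) (θ : ℕ → ℕ) : Prop where
  mapsTo : ∀ i ∈ Set.Ico m n, θ i ∈ Set.Ico m n
  involutive : ∀ i ∈ Set.Ico m n, θ (θ i) = i
  noncrossing : ∀ i ∈ Set.Ico m n, ∀ j ∈ Set.Ico m n, ¬ (i < j ∧ j < θ i ∧ θ i < θ j)

section Norm

variable {X : Type*} [MetricSpace X]

/-- The quantity `N^θ_Γ(w)`, where the letters of the word `w` are placed at the positions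
`m, m + 1, …, m + |w| - 1` and `θ` is a match on these positions. In the third case the last
position is `m + (|t| + 1)`: either `θ m` is smaller, and `w = w₁ w₂` with `w₁` ending at
position `θ m`, or `θ m` is the last position, and `w = x⁻¹ w₁ y` with `x = a⁻¹`.
The empty word, which can only occur as such a `w₁`, has the value `0`. -/
noncomputable def matchNorm (Γ : Scale X) (θ : ℕ → ℕ) : ℕ → List (Letter X) → ℝ≥0
  | _, [] => 0
  | _, [x] => Letter.d Letter.e x
  | m, a :: b :: t =>
    if θ m < m + (t.length + 1) then
      matchNorm Γ θ m ((a :: b :: t).take (θ m - m + 1)) +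
        matchNorm Γ θ (m + (θ m - m + 1)) ((a :: b :: t).drop (θ m - m + 1))
    else
      let x := a.inv
      let y := (b :: t).getLast (List.cons_ne_nil b t)
      let s := matchNorm Γ θ (m + 1) (b :: t).dropLast
      Letter.d x y + max (Γ.toFun x s) (Γ.toFun y s)
  termination_by _ w => w.length
  decreasing_by
    all_goals simp
    all_goals omega

/-- `N_Γ(u)`: the infimum of `N^θ_Γ(w)` over all nonempty words `w` with value `u` and all
matches `θ`. -/
noncomputable def scaleNorm (Γ : Scale X) (u : FreeGroup X) : ℝ≥0 :=
  sInf {r | ∃ (w : List (Letter X)) (θ : ℕ → ℕ),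
    w ≠ [] ∧ wordVal w = u ∧ IsMatch 0 w.length θ ∧ matchNorm Γ θ 0 w = r}

/-- `δ_Γ(u, v) = N_Γ(u⁻¹ v)`. -/
noncomputable def scaleDelta (Γ : Scale X) (u v : FreeGroup X) : ℝ≥0 := scaleNorm Γ (u⁻¹ * v)

/-- The values `N^θ_Γ(w)` generated without reference to matches (an auxiliary description). -/
inductive MatchVal (Γ : Scale X) : List (Letter X) → ℝ≥0 → Prop
  | nil : MatchVal Γ [] 0
  | single (x : Letter X) : MatchVal Γ [x] (Letter.d Letter.e x)
  | append {u v : List (Letter X)} {r s : ℝ≥0} :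
      MatchVal Γ u r → MatchVal Γ v s → MatchVal Γ (u ++ v) (r + s)
  | wrap (x y : Letter X) {u : List (Letter X)} {s : ℝ≥0} : MatchVal Γ u s →
      MatchVal Γ (x.inv :: (u ++ [y])) (Letter.d x y + max (Γ.toFun x s) (Γ.toFun y s))

theorem IsMatch.split {m n : ℕ} {θ : ℕ → ℕ} (h : IsMatch m n θ) (hmn : m < n) :
    IsMatch m (θ m + 1) θ ∧ IsMatch (θ m + 1) n θ := by
  have hm : m ∈ Set.Ico m n := ⟨le_rfl, hmn⟩
  have h0 := h.mapsTo m hm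
  have h1 := h.involutive m hm
  simp only [Set.mem_Ico] at h0
  have hin : ∀ i, m ≤ i → i ≤ θ m → m ≤ θ i ∧ θ i ≤ θ m := by
    intro i hi1 hi2
    have hi : i ∈ Set.Ico m n := ⟨hi1, by omega⟩
    have hi3 := h.mapsTo i hi
    refine ⟨hi3.1, ?_⟩
    rcases hi1.eq_or_lt with rfl | hi1
    · exact le_rfl
    rcases hi2.eq_or_lt with rfl | hi2
    · rw [h1]; exact h0.1
    by_contra hcon
    exact h.noncrossing m hm i hi ⟨hi1, hi2, by omega⟩
  constructor
  · refine ⟨fun i hi => ?_, fun i hi => h.involutive i ⟨hi.1, by have := hi.2; omega⟩,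
      fun i hi j hj => h.noncrossing i ⟨hi.1, by have := hi.2; omega⟩ j
        ⟨hj.1, by have := hj.2; omega⟩⟩
    have := hin i hi.1 (by have := hi.2; omega)
    exact ⟨this.1, by omega⟩
  · refine ⟨fun i hi => ?_, fun i hi => h.involutive i ⟨by have := hi.1; omega, hi.2⟩,
      fun i hi j hj => h.noncrossing i ⟨by have := hi.1; omega, hi.2⟩ j
        ⟨by have := hj.1; omega, hj.2⟩⟩
    have hi' : i ∈ Set.Ico m n := ⟨by have := hi.1; omega, hi.2⟩
    have h3 := h.mapsTo i hi'
    have h4 := h.involutive i hi'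
    refine ⟨?_, h3.2⟩
    by_contra hcon
    have := hin (θ i) h3.1 (by omega)
    have := hi.1
    omega

theorem matchVal_of_isMatch (Γ : Scale X) (θ : ℕ → ℕ) (m : ℕ) (w : List (Letter X))
    (h : IsMatch m (m + w.length) θ) : MatchVal Γ w (matchNorm Γ θ m w) := by
  induction hn : w.length using Nat.strong_induction_on generalizing m w with
  | _ n ih =>
  match w with
  | [] => rw [matchNorm]; exact .nil
  | [x] => rw [matchNorm]; exact .single x
  | a :: b :: t =>
    have hm : m ∈ Set.Ico m (m + (a :: b :: t).length) := by simp
    have h0 := h.mapsTo m hm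
    have h1 := h.involutive m hm
    have hs := h.split hm.2
    simp only [Set.mem_Ico, List.length_cons] at h0 hn
    rw [matchNorm]
    split_ifs with hc
    · have key : MatchVal Γ
          ((a :: b :: t).take (θ m - m + 1) ++ (a :: b :: t).drop (θ m - m + 1))
          (matchNorm Γ θ m ((a :: b :: t).take (θ m - m + 1)) +
        matchNorm Γ θ (m + (θ m - m + 1)) ((a :: b :: t).drop (θ m - m + 1))) := by
        refine .append (ih _ ?_ m _ ?_ rfl) (ih _ ?_ _ _ ?_ rfl)
        · simp; omega
        · have hl : m + ((a :: b :: t).take (θ m - m + 1)).length = θ m + 1 := by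
            simp; omega
          rw [hl]
          exact hs.1
        · simp; omega
        · have hl : m + (θ m - m + 1) + ((a :: b :: t).drop (θ m - m + 1)).length
              = m + (a :: b :: t).length := by
            simp; omega
          have hl' : m + (θ m - m + 1) = θ m + 1 := by omega
          rw [hl, hl']
          exact hs.2
      rwa [List.take_append_drop] at key
    · have hθ : θ m = m + (t.length + 1) := by omega
      have key := MatchVal.wrap (Γ := Γ) a.inv ((b :: t).getLast (List.cons_ne_nil b t))
        (u := (b :: t).dropLast) (s := matchNorm Γ θ (m + 1) (b :: t).dropLast) (by
          refine ih _ ?_ _ _ ?_ rfl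
          · simp; omega
          · have hl : m + 1 + (b :: t).dropLast.length = m + (t.length + 1) := by
              simp; omega
            rw [hl]
            refine ⟨fun i hi => ?_, fun i hi => h.involutive i ?_,
              fun i hi j hj => h.noncrossing i ?_ j ?_⟩
            · simp only [Set.mem_Ico] at hi ⊢
              have hi' : i ∈ Set.Ico m (m + (a :: b :: t).length) := by
                simp only [Set.mem_Ico, List.length_cons]; omega
              have h3 := h.mapsTo i hi'
              have h4 := h.involutive i hi'
              simp only [Set.mem_Ico, List.length_cons] at h3
              have h5 : θ i ≠ m := fun h' => by rw [h'] at h4; omega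
              have h6 : θ i ≠ m + (t.length + 1) := fun h' => by
                rw [h', ← hθ, h1] at h4; omega
              omega
            all_goals simp only [Set.mem_Ico, List.length_cons] at hi ⊢; try simp only [Set.mem_Ico] at hj
            all_goals omega)
      rwa [Letter.inv_inv, List.dropLast_append_getLast] at key

theorem matchNorm_shift (Γ : Scale X) (θ η : ℕ → ℕ) (s m m' : ℕ) (w : List (Letter X))
    (hm : m' = m + s)
    (h : ∀ i, m ≤ i → i < m + w.length → η (i + s) = θ i + s) :
    matchNorm Γ η m' w = matchNorm Γ θ m w := by
  subst hm
  induction hn : w.length using Nat.strong_induction_on generalizing m w with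
  | _ n ih =>
  match w with
  | [] => rw [matchNorm, matchNorm]
  | [x] => rw [matchNorm, matchNorm]
  | a :: b :: t =>
    have h0 := h m le_rfl (by simp)
    simp only [List.length_cons] at hn h
    rw [matchNorm, matchNorm, h0]
    have e1 : θ m + s - (m + s) = θ m - m := by omega
    rw [e1]
    split_ifs with h2 h3 h3
    · have e2 : m + s + (θ m - m + 1) = m + (θ m - m + 1) + s := by omega
      rw [e2]
      congr 1
      · refine ih _ ?_ m _ (fun i hi hi' => h i hi ?_) rfl
        · simp; omega
        · simp at hi'; omega
      · refine ih _ ?_ _ _ (fun i hi hi' => h i (by omega) ?_) rfl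
        · simp; omega
        · simp at hi'; omega
    · omega
    · omega
    · have e2 : m + s + 1 = m + 1 + s := by omega
      have e3 : matchNorm Γ η (m + 1 + s) (b :: t).dropLast
          = matchNorm Γ θ (m + 1) (b :: t).dropLast := by
        refine ih _ ?_ _ _ (fun i hi hi' => h i (by omega) ?_) rfl
        · simp; omega
        · simp at hi'; omega
      rw [e2, e3]

theorem matchNorm_append (Γ : Scale X) (θ : ℕ → ℕ) (m : ℕ) (u v : List (Letter X))
    (hu : IsMatch m (m + u.length) θ) :
    matchNorm Γ θ m (u ++ v) = matchNorm Γ θ m u + matchNorm Γ θ (m + u.length) v := by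
  induction hn : u.length using Nat.strong_induction_on generalizing m u with
  | _ n ih =>
  subst hn
  match u with
  | [] => simp [matchNorm]
  | [x] =>
    match v with
    | [] => simp [matchNorm]
    | b :: t =>
      have h0 := hu.mapsTo m (by simp)
      simp only [Set.mem_Ico, List.length_cons, List.length_nil] at h0
      have h1 : θ m = m := by omega
      have e : [x] ++ b :: t = x :: b :: t := rfl
      rw [e]
      conv_lhs => rw [matchNorm, if_pos (by omega), h1]
      simp
  | a :: b :: t =>
    have h0 := hu.mapsTo m (by simp)
    simp only [Set.mem_Ico, List.length_cons] at h0
    have hs := hu.split (by simp)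
    by_cases hv : v = []
    · subst hv; simp [matchNorm]
    have hv' : 0 < v.length := List.length_pos_iff.2 hv
    have e : a :: b :: t ++ v = a :: b :: (t ++ v) := rfl
    rw [e, matchNorm, if_pos (by rw [List.length_append]; omega), ← e]
    rw [List.take_append_of_le_length (by simp; omega),
      List.drop_append_of_le_length (by simp; omega)]
    by_cases hc : θ m < m + (t.length + 1)
    · rw [ih _ (by simp) (m + (θ m - m + 1)) _ ?_ rfl]
      · have hl : m + (θ m - m + 1) + ((a :: b :: t).drop (θ m - m + 1)).length
              = m + (a :: b :: t).length := by
            simp only [List.length_drop, List.length_cons]; omega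
        conv_rhs => rw [matchNorm, if_pos hc]
        rw [hl, ← add_assoc]
      · have hl : m + (θ m - m + 1) + ((a :: b :: t).drop (θ m - m + 1)).length
              = m + (a :: b :: t).length := by
            simp; omega
        have hl' : m + (θ m - m + 1) = θ m + 1 := by omega
        rw [hl, hl']
        exact hs.2
    · have hk : θ m - m + 1 = (a :: b :: t).length := by simp; omega
      rw [hk, List.take_length, List.drop_length, List.nil_append]

theorem exists_isMatch (Γ : Scale X) {w : List (Letter X)} {r : ℝ≥0} (h : MatchVal Γ w r) :
    ∃ θ, IsMatch 0 w.length θ ∧ matchNorm Γ θ 0 w = r := by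
  induction h with
  | nil => exact ⟨id, ⟨fun _ h => h, fun _ _ => rfl, fun i _ j _ h => by simp at h; omega⟩,
      by rw [matchNorm]⟩
  | single x => exact ⟨id, ⟨fun _ h => h, fun _ _ => rfl, fun i _ j _ h => by simp at h; omega⟩,
      by rw [matchNorm]⟩
  | @append u v r s _ _ ihu ihv =>
    obtain ⟨θ, hθ, rfl⟩ := ihu
    obtain ⟨η, hη, rfl⟩ := ihv
    let ζ : ℕ → ℕ := fun i => if i < u.length then θ i else η (i - u.length) + u.length
    have z1 : ∀ i, i < u.length → ζ i = θ i ∧ θ i < u.length := fun i hi =>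
      ⟨if_pos hi, (hθ.mapsTo i ⟨Nat.zero_le _, hi⟩).2⟩
    have z2 : ∀ i, i < v.length → ζ (i + u.length) = η i + u.length ∧ η i < v.length :=
      fun i hi => ⟨by simp [ζ], (hη.mapsTo i ⟨Nat.zero_le _, hi⟩).2⟩
    have hcase : ∀ i, i < (u ++ v).length → i < u.length ∨ ∃ j, j < v.length ∧
        i = j + u.length := by
      intro i hi
      rw [List.length_append] at hi
      by_cases h : i < u.length
      · exact .inl h
      · exact .inr ⟨i - u.length, by omega, by omega⟩
    have hζu : IsMatch 0 (0 + u.length) ζ := by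
      refine ⟨fun i hi => ?_, fun i hi => ?_, fun i hi j hj => ?_⟩
      · have := z1 i (by simpa using hi.2)
        exact ⟨Nat.zero_le _, by omega⟩
      · have := z1 i (by simpa using hi.2)
        rw [this.1, (z1 _ this.2).1]
        exact hθ.involutive i (by simpa using hi)
      · rw [(z1 i (by simpa using hi.2)).1, (z1 j (by simpa using hj.2)).1]
        exact hθ.noncrossing i (by simpa using hi) j (by simpa using hj)
    refine ⟨ζ, ⟨fun i hi => ?_, fun i hi => ?_, fun i hi j hj => ?_⟩, ?_⟩
    · refine ⟨Nat.zero_le _, ?_⟩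
      rw [List.length_append]
      rcases hcase i hi.2 with h | ⟨k, hk, rfl⟩
      · have := z1 i h; omega
      · have := z2 k hk; omega
    · rcases hcase i hi.2 with h | ⟨k, hk, rfl⟩
      · have := z1 i h
        rw [this.1, (z1 _ this.2).1]
        exact hθ.involutive i ⟨Nat.zero_le _, h⟩
      · have := z2 k hk
        rw [this.1, (z2 _ this.2).1, hη.involutive k ⟨Nat.zero_le _, hk⟩]
    · rcases hcase i hi.2 with h | ⟨k, hk, rfl⟩ <;> rcases hcase j hj.2 with h' | ⟨l, hl, rfl⟩
      · rw [(z1 i h).1, (z1 j h').1]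
        exact hθ.noncrossing i ⟨Nat.zero_le _, h⟩ j ⟨Nat.zero_le _, h'⟩
      · have := z1 i h; omega
      · omega
      · rw [(z2 k hk).1, (z2 l hl).1]
        have := hη.noncrossing k ⟨Nat.zero_le _, hk⟩ l ⟨Nat.zero_le _, hl⟩
        omega
    · rw [matchNorm_append Γ ζ 0 u v hζu]
      congr 1
      · exact matchNorm_shift Γ θ ζ 0 0 0 u rfl fun i _ hi => (z1 i (by simpa using hi)).1
      · exact matchNorm_shift Γ η ζ u.length 0 _ v rfl
          fun i _ hi => (z2 i (by simpa using hi)).1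
  | @wrap x y u s _ ih =>
    obtain ⟨θ, hθ, rfl⟩ := ih
    let ζ : ℕ → ℕ := fun i => if i = 0 then u.length + 1 else
      if i = u.length + 1 then 0 else θ (i - 1) + 1
    have z0 : ζ 0 = u.length + 1 := rfl
    have zl : ζ (u.length + 1) = 0 := by simp [ζ]
    have z1 : ∀ i, i < u.length → ζ (i + 1) = θ i + 1 ∧ θ i < u.length := fun i hi =>
      ⟨by simp [ζ]; omega, (hθ.mapsTo i ⟨Nat.zero_le _, hi⟩).2⟩
    have hlen : (x.inv :: (u ++ [y])).length = u.length + 2 := by simp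
    have hcase : ∀ i, i < (x.inv :: (u ++ [y])).length → i = 0 ∨ i = u.length + 1 ∨
        ∃ j, j < u.length ∧ i = j + 1 := by
      intro i hi
      rw [hlen] at hi
      by_cases h : i = 0
      · exact .inl h
      by_cases h' : i = u.length + 1
      · exact .inr (.inl h')
      · exact .inr (.inr ⟨i - 1, by omega, by omega⟩)
    refine ⟨ζ, ⟨fun i hi => ?_, fun i hi => ?_, fun i hi j hj => ?_⟩, ?_⟩
    · refine ⟨Nat.zero_le _, ?_⟩
      rw [hlen]
      rcases hcase i hi.2 with rfl | rfl | ⟨k, hk, rfl⟩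
      · omega
      · omega
      · have := z1 k hk; omega
    · rcases hcase i hi.2 with rfl | rfl | ⟨k, hk, rfl⟩
      · rw [z0, zl]
      · rw [zl, z0]
      · have := z1 k hk
        rw [this.1, (z1 _ this.2).1, hθ.involutive k ⟨Nat.zero_le _, hk⟩]
    · rw [Set.mem_Ico, hlen] at hi hj
      rcases hcase i (by omega) with rfl | rfl | ⟨k, hk, rfl⟩ <;>
        rcases hcase j (by omega) with rfl | rfl | ⟨l, hl, rfl⟩
      · omega
      · omega
      · have := z1 l hl; omega
      · omega
      · omega
      · omega
      · omega
      · omega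
      · rw [(z1 k hk).1, (z1 l hl).1]
        have := hθ.noncrossing k ⟨Nat.zero_le _, hk⟩ l ⟨Nat.zero_le _, hl⟩
        omega
    · obtain ⟨b, t, hbt⟩ : ∃ b t, u ++ [y] = b :: t := by
        cases u with
        | nil => exact ⟨y, [], rfl⟩
        | cons b t => exact ⟨b, t ++ [y], rfl⟩
      have hd : (b :: t).dropLast = u := by rw [← hbt]; simp
      have hg : (b :: t).getLast (List.cons_ne_nil b t) = y := by simp [← hbt]
      have hl : t.length = u.length := by
        have := congrArg List.length hbt
        simp at this; omega
      rw [hbt, matchNorm, if_neg (by rw [z0]; omega), hd, hg, Letter.inv_inv]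
      have : matchNorm Γ ζ (0 + 1) u = matchNorm Γ θ 0 u :=
        matchNorm_shift Γ θ ζ 1 0 _ u rfl fun i _ hi => (z1 i (by simpa using hi)).1
      simp only [this]

theorem scaleNorm_le (Γ : Scale X) {w : List (Letter X)} {r : ℝ≥0} (h : MatchVal Γ w r) :
    scaleNorm Γ (wordVal w) ≤ r := by
  have h' := MatchVal.append h (.single Letter.e)
  rw [Letter.d_self, add_zero] at h'
  obtain ⟨θ, h1, h2⟩ := exists_isMatch Γ h'
  refine csInf_le (OrderBot.bddBelow _) ⟨_, θ, by simp, ?_, h1, h2⟩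
  simp [wordVal, Letter.val]

theorem exists_matchVal_lt (Γ : Scale X) (u : FreeGroup X) {r : ℝ≥0} (h : scaleNorm Γ u < r) :
    ∃ w s, wordVal w = u ∧ MatchVal Γ w s ∧ s < r := by
  obtain ⟨s, ⟨w, θ, -, hw, hθ, rfl⟩, hs⟩ := exists_lt_of_csInf_lt (by
    obtain ⟨w, hw⟩ := exists_wordVal u
    exact ⟨_, w ++ [.e], id, by simp, by simpa [wordVal, Letter.val] using hw,
      ⟨fun _ h => h, fun _ _ => rfl, fun i _ j _ h => by simp at h; omega⟩, rfl⟩) h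
  exact ⟨w, _, hw, matchVal_of_isMatch Γ θ 0 w (by simpa using hθ), hs⟩

theorem scaleNorm_one (Γ : Scale X) : scaleNorm Γ 1 = 0 :=
  le_antisymm (scaleNorm_le Γ .nil) (zero_le)

theorem scaleNorm_mul_le (Γ : Scale X) (u v : FreeGroup X) :
    scaleNorm Γ (u * v) ≤ scaleNorm Γ u + scaleNorm Γ v := by
  refine le_of_forall_pos_le_add fun ε hε => ?_
  obtain ⟨w, r, rfl, hw, hr⟩ := exists_matchVal_lt Γ u
    (lt_add_of_pos_right (scaleNorm Γ u) (half_pos hε))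
  obtain ⟨w', r', rfl, hw', hr'⟩ := exists_matchVal_lt Γ v
    (lt_add_of_pos_right (scaleNorm Γ v) (half_pos hε))
  rw [← wordVal_append]
  refine (scaleNorm_le Γ (hw.append hw')).trans ((add_le_add hr.le hr'.le).trans ?_)
  rw [add_add_add_comm, add_halves]

theorem MatchVal.inv {Γ : Scale X} {w : List (Letter X)} {r : ℝ≥0} (h : MatchVal Γ w r) :
    MatchVal Γ (w.map Letter.inv).reverse r := by
  induction h with
  | nil => exact .nil
  | single x =>
    have : Letter.d Letter.e x = Letter.d Letter.e x.inv := (Letter.d_inv Letter.e x).symm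
    rw [this]
    exact .single _
  | append _ _ ihu ihv =>
    rw [List.map_append, List.reverse_append, add_comm]
    exact ihv.append ihu
  | @wrap x y u s _ ih =>
    have := MatchVal.wrap y x ih
    rw [Letter.d_comm, max_comm]
    simpa [Letter.inv_inv] using this

theorem scaleNorm_inv (Γ : Scale X) (u : FreeGroup X) : scaleNorm Γ u⁻¹ = scaleNorm Γ u := by
  have key : ∀ u, scaleNorm Γ u⁻¹ ≤ scaleNorm Γ u := by
    refine fun u => le_of_forall_gt fun c hc => ?_
    obtain ⟨w, r, rfl, hw, hr⟩ := exists_matchVal_lt Γ u hc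
    rw [← wordVal_inv]
    exact (scaleNorm_le Γ hw.inv).trans_lt hr
  exact le_antisymm (key u) (by simpa using key u⁻¹)

theorem scaleNorm_conj_letter (Γ : Scale X) (x : Letter X) {u : FreeGroup X} {r : ℝ≥0}
    (h : scaleNorm Γ u < r) : scaleNorm Γ (x.val⁻¹ * u * x.val) ≤ Γ.toFun x r := by
  obtain ⟨w, s, rfl, hw, hs⟩ := exists_matchVal_lt Γ u h
  have := scaleNorm_le Γ (MatchVal.wrap x x hw)
  rw [wordVal_cons, wordVal_append, Letter.val_inv, Letter.d_self, zero_add, max_self,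
    ← mul_assoc] at this
  refine le_trans ?_ (this.trans (Γ.mono x hs.le))
  simp [wordVal]

theorem scaleNorm_conj (Γ : Scale X) (g : FreeGroup X) :
    ∀ ε > 0, ∃ η > 0, ∀ u, scaleNorm Γ u < η → scaleNorm Γ (g⁻¹ * u * g) < ε := by
  obtain ⟨w, rfl⟩ := exists_wordVal g
  induction w with
  | nil => exact fun ε hε => ⟨ε, hε, fun u hu => by simpa [wordVal] using hu⟩
  | cons x w ih =>
    intro ε hε
    obtain ⟨ε', hε', h⟩ := ih ε hε
    have h1 := (Γ.tendsto_zero x).eventually (gt_mem_nhds hε')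
    obtain ⟨η, h2, hη⟩ := (h1.and self_mem_nhdsWithin).exists
    refine ⟨η, hη, fun u hu => ?_⟩
    have := h _ ((scaleNorm_conj_letter Γ x hu).trans_lt h2)
    rw [wordVal_cons]
    convert this using 2
    group

end Norm

section Group

variable {X : Type*} [MetricSpace X]

/-- The group `F_Γ(X)`: the free group on `X`, to be equipped with the metric `d_Γ`. -/
def ScaledFreeGroup (_Γ : Scale X) : Type _ := FreeGroup X

noncomputable instance (Γ : Scale X) : Group (ScaledFreeGroup Γ) :=
  inferInstanceAs (Group (FreeGroup X))

theorem scaleDelta_self (Γ : Scale X) (u : FreeGroup X) : scaleDelta Γ u u = 0 := by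
  simp [scaleDelta, scaleNorm_one]

theorem scaleDelta_comm (Γ : Scale X) (u v : FreeGroup X) :
    scaleDelta Γ u v = scaleDelta Γ v u := by
  rw [scaleDelta, scaleDelta, ← scaleNorm_inv]; simp

theorem scaleDelta_triangle (Γ : Scale X) (u v w : FreeGroup X) :
    scaleDelta Γ u w ≤ scaleDelta Γ u v + scaleDelta Γ v w := by
  have := scaleNorm_mul_le Γ (u⁻¹ * v) (v⁻¹ * w)
  rwa [show u⁻¹ * v * (v⁻¹ * w) = u⁻¹ * w by group] at this

/-- The metric `d_Γ(u, v) = δ_Γ(u⁻¹, v⁻¹) + δ_Γ(u, v)` on `F_Γ(X)`. (Only the axioms of a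
pseudometric are needed for the completion.) -/
noncomputable instance (Γ : Scale X) : PseudoMetricSpace (ScaledFreeGroup Γ) where
  dist u v := (scaleDelta Γ u⁻¹ v⁻¹ + scaleDelta Γ u v : ℝ≥0)
  dist_self u := by
    have h1 := scaleDelta_self Γ u
    have h2 := scaleDelta_self Γ (u⁻¹ : FreeGroup X)
    exact_mod_cast (by rw [h1]; exact h2 ▸ (by simp : (0 : ℝ≥0) + 0 = 0))
  dist_comm u v := by
    have h1 := scaleDelta_comm Γ u v
    have h2 := scaleDelta_comm Γ (u⁻¹ : FreeGroup X) v⁻¹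
    exact congrArg _ (congrArg₂ _ h2 h1)
  dist_triangle u v w := by
    have h1 := scaleDelta_triangle Γ u v w
    have h2 := scaleDelta_triangle Γ (u⁻¹ : FreeGroup X) v⁻¹ w⁻¹
    have h3 := add_le_add h2 h1
    rw [add_add_add_comm] at h3
    exact_mod_cast h3

theorem ScaledFreeGroup.dist_def (Γ : Scale X) (u v : ScaledFreeGroup Γ) :
    dist u v = (scaleNorm Γ (u * v⁻¹ : ScaledFreeGroup Γ) : ℝ) +
      scaleNorm Γ (u⁻¹ * v : ScaledFreeGroup Γ) := by
  have : scaleDelta Γ (u⁻¹ : ScaledFreeGroup Γ) (v⁻¹ : ScaledFreeGroup Γ)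
      = scaleNorm Γ (u * v⁻¹ : ScaledFreeGroup Γ) := by
    change scaleNorm Γ ((u⁻¹)⁻¹ * v⁻¹ : ScaledFreeGroup Γ) = _
    rw [_root_.inv_inv]
  rw [← this]
  rfl

theorem ScaledFreeGroup.isometry_inv (Γ : Scale X) :
    Isometry fun u : ScaledFreeGroup Γ => u⁻¹ := by
  refine Isometry.of_dist_eq fun u v => ?_
  rw [dist_def, dist_def, _root_.inv_inv, _root_.inv_inv, add_comm]

theorem ScaledFreeGroup.conj_aux (Γ : Scale X) (A B : Filter (ScaledFreeGroup Γ))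
    (hA : Cauchy A) (hB : Cauchy B) {ε : ℝ} (hε : 0 < ε) :
    ∃ S ∈ A, ∃ T ∈ B, ∀ x ∈ S, ∀ x' ∈ S, ∀ y ∈ T, ∀ y' ∈ T,
      (scaleNorm Γ ((x * y)⁻¹ * (x' * y') : ScaledFreeGroup Γ) : ℝ) < ε := by
  have hε3 : 0 < ε / 3 := by positivity
  obtain ⟨-, hB'⟩ := Metric.cauchy_iff.1 hB
  obtain ⟨T, hT, hTd⟩ := hB' _ hε3
  have := hB.1
  obtain ⟨y0, hy0⟩ := Filter.nonempty_of_mem hT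
  obtain ⟨η, hη, hc⟩ := scaleNorm_conj Γ (y0 : FreeGroup X) ⟨ε / 3, hε3.le⟩
    (by exact_mod_cast hε3)
  obtain ⟨-, hA'⟩ := Metric.cauchy_iff.1 hA
  obtain ⟨S, hS, hSd⟩ := hA' η (by exact_mod_cast hη)
  refine ⟨S, hS, T, hT, fun x hx x' hx' y hy y' hy' => ?_⟩
  have small : ∀ a b : ScaledFreeGroup Γ,
      (scaleNorm Γ (a⁻¹ * b : ScaledFreeGroup Γ) : ℝ) ≤ dist a b := fun a b => by
    rw [dist_def]; exact le_add_of_nonneg_left (NNReal.coe_nonneg _)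
  have h1 := (small y y0).trans_lt (hTd y hy y0 hy0)
  have h2 := (small y0 y').trans_lt (hTd y0 hy0 y' hy')
  have h3 : scaleNorm Γ (x⁻¹ * x' : ScaledFreeGroup Γ) < η := by
    exact_mod_cast (small x x').trans_lt (hSd x hx x' hx')
  have h4 : (scaleNorm Γ (y0⁻¹ * (x⁻¹ * x') * y0 : ScaledFreeGroup Γ) : ℝ) < ε / 3 :=
    hc _ h3
  have h5 := scaleNorm_mul_le Γ (y⁻¹ * y0 * (y0⁻¹ * (x⁻¹ * x') * y0) : ScaledFreeGroup Γ)
    (y0⁻¹ * y' : ScaledFreeGroup Γ)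
  have h6 := scaleNorm_mul_le Γ (y⁻¹ * y0 : ScaledFreeGroup Γ)
    (y0⁻¹ * (x⁻¹ * x') * y0 : ScaledFreeGroup Γ)
  have e : (x * y)⁻¹ * (x' * y') =
      y⁻¹ * y0 * (y0⁻¹ * (x⁻¹ * x') * y0) * (y0⁻¹ * y') := by group
  rw [e]
  have h7 : (scaleNorm Γ (y⁻¹ * y0 * (y0⁻¹ * (x⁻¹ * x') * y0) * (y0⁻¹ * y') :
      ScaledFreeGroup Γ) : ℝ) ≤ scaleNorm Γ (y⁻¹ * y0 : ScaledFreeGroup Γ) +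
      scaleNorm Γ (y0⁻¹ * (x⁻¹ * x') * y0 : ScaledFreeGroup Γ) +
      scaleNorm Γ (y0⁻¹ * y' : ScaledFreeGroup Γ) := by
    exact_mod_cast h5.trans (add_le_add_left h6 _)
  linarith

theorem ScaledFreeGroup.cauchy_mul (Γ : Scale X) (A B : Filter (ScaledFreeGroup Γ))
    (hA : Cauchy A) (hB : Cauchy B) :
    Cauchy (map (fun p : ScaledFreeGroup Γ × ScaledFreeGroup Γ => p.1 * p.2) (A ×ˢ B)) := by
  have := hA.1
  have := hB.1
  refine Metric.cauchy_iff.2 ⟨inferInstance, fun ε hε => ?_⟩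
  have huc := (isometry_inv Γ).uniformContinuous
  obtain ⟨S, hS, T, hT, h⟩ := conj_aux Γ A B hA hB (half_pos hε)
  obtain ⟨T', hT', S', hS', h'⟩ := conj_aux Γ _ _ (hB.map huc) (hA.map huc) (half_pos hε)
  refine ⟨_, image_mem_map (prod_mem_prod (inter_mem hS (mem_map.1 hS'))
    (inter_mem hT (mem_map.1 hT'))), ?_⟩
  rintro _ ⟨⟨x, y⟩, ⟨hx, hy⟩, rfl⟩ _ ⟨⟨x', y'⟩, ⟨hx', hy'⟩, rfl⟩
  have h1 := h x hx.1 x' hx'.1 y hy.1 y' hy'.1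
  have h2 := h' _ hy.2 _ hy'.2 _ hx.2 _ hx'.2
  rw [dist_def]
  have e : (y⁻¹ * x⁻¹)⁻¹ * (y'⁻¹ * x'⁻¹) = x * y * (x' * y')⁻¹ := by group
  rw [e] at h2
  simp only
  linarith

/-- The group `F̄_Γ(X)`: the completion of `F_Γ(X)` with respect to the metric `d_Γ`. -/
def CompletedFreeGroup (Γ : Scale X) : Type _ :=
  UniformSpace.Completion (ScaledFreeGroup Γ)

namespace CompletedFreeGroup

variable (Γ : Scale X)

noncomputable instance : MetricSpace (CompletedFreeGroup Γ) :=
  inferInstanceAs (MetricSpace (UniformSpace.Completion (ScaledFreeGroup Γ)))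

instance : CompleteSpace (CompletedFreeGroup Γ) :=
  inferInstanceAs (CompleteSpace (UniformSpace.Completion (ScaledFreeGroup Γ)))

/-- The canonical map `F_Γ(X) → F̄_Γ(X)`. -/
noncomputable def mk (u : ScaledFreeGroup Γ) : CompletedFreeGroup Γ :=
  (u : UniformSpace.Completion (ScaledFreeGroup Γ))

theorem isometry_mk : Isometry (mk Γ) := UniformSpace.Completion.coe_isometry

theorem isDenseInducing_mk : IsDenseInducing (mk Γ) :=
  UniformSpace.Completion.isDenseInducing_coe

theorem isDenseInducing_mk₂ : IsDenseInducing (Prod.map (mk Γ) (mk Γ)) :=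
  (isDenseInducing_mk Γ).prodMap (isDenseInducing_mk Γ)

theorem tendsto_mul (p : CompletedFreeGroup Γ × CompletedFreeGroup Γ) :
    ∃ c, Tendsto (fun q : ScaledFreeGroup Γ × ScaledFreeGroup Γ => mk Γ (q.1 * q.2))
      (comap (Prod.map (mk Γ) (mk Γ)) (𝓝 p)) (𝓝 c) := by
  have hc : ∀ a, Cauchy (comap (mk Γ) (𝓝 a)) := fun a =>
    cauchy_nhds.comap' (isometry_mk Γ).isUniformInducing.comap_uniformity.le
      ((isDenseInducing_mk Γ).comap_nhds_neBot a)
  have h := (ScaledFreeGroup.cauchy_mul Γ _ _ (hc p.1) (hc p.2)).map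
    (isometry_mk Γ).uniformContinuous
  obtain ⟨c, hc⟩ := CompleteSpace.complete h
  refine ⟨c, ?_⟩
  rw [Filter.map_map, prod_comap_comap_eq, ← nhds_prod_eq] at hc
  exact hc

/-- The multiplication is the continuous extension of the multiplication of `F_Γ(X)`. -/
noncomputable instance : Mul (CompletedFreeGroup Γ) where
  mul a b := (isDenseInducing_mk₂ Γ).extend
    (fun q : ScaledFreeGroup Γ × ScaledFreeGroup Γ => mk Γ (q.1 * q.2)) (a, b)

/-- The inversion is the continuous extension of the inversion of `F_Γ(X)`. -/
noncomputable instance : Inv (CompletedFreeGroup Γ) where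
  inv a := (isDenseInducing_mk Γ).extend (fun u : ScaledFreeGroup Γ => mk Γ u⁻¹) a

noncomputable instance : One (CompletedFreeGroup Γ) := ⟨mk Γ 1⟩

theorem continuous_mul' :
    Continuous fun p : CompletedFreeGroup Γ × CompletedFreeGroup Γ => p.1 * p.2 :=
  (isDenseInducing_mk₂ Γ).continuous_extend (tendsto_mul Γ)

theorem mk_mul (u v : ScaledFreeGroup Γ) : mk Γ (u * v) = mk Γ u * mk Γ v :=
  ((isDenseInducing_mk₂ Γ).extend_eq' (tendsto_mul Γ) (u, v)).symm

theorem uniformContinuous_mk_inv : UniformContinuous fun u : ScaledFreeGroup Γ => mk Γ u⁻¹ :=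
  ((isometry_mk Γ).comp (ScaledFreeGroup.isometry_inv Γ)).uniformContinuous

theorem continuous_inv' : Continuous fun a : CompletedFreeGroup Γ => a⁻¹ :=
  (uniformContinuous_uniformly_extend (isometry_mk Γ).isUniformInducing
    (isDenseInducing_mk Γ).dense (uniformContinuous_mk_inv Γ)).continuous

theorem mk_inv (u : ScaledFreeGroup Γ) : mk Γ u⁻¹ = (mk Γ u)⁻¹ :=
  ((isDenseInducing_mk Γ).extend_eq (uniformContinuous_mk_inv Γ).continuous u).symm

noncomputable instance : Group (CompletedFreeGroup Γ) :=
  Group.ofLeftAxioms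
    (fun a b c => by
      have hm := continuous_mul' Γ
      refine UniformSpace.Completion.induction_on₃ (α := ScaledFreeGroup Γ)
        (β := ScaledFreeGroup Γ) (γ := ScaledFreeGroup Γ)
        (p := fun a b c : CompletedFreeGroup Γ => a * b * c = a * (b * c)) a b c
        (isClosed_eq ?_ ?_) fun u v w => ?_
      · exact hm.comp ((hm.comp (continuous_fst.prodMk continuous_snd.fst)).prodMk
          continuous_snd.snd)
      · exact hm.comp (continuous_fst.prodMk (hm.comp continuous_snd))
      · change mk Γ u * mk Γ v * mk Γ w = mk Γ u * (mk Γ v * mk Γ w)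
        simp only [← mk_mul, mul_assoc])
    (fun a => by
      refine UniformSpace.Completion.induction_on (α := ScaledFreeGroup Γ)
        (p := fun a : CompletedFreeGroup Γ => 1 * a = a) a
        (isClosed_eq (X := CompletedFreeGroup Γ) (Y := CompletedFreeGroup Γ) ?_ continuous_id)
        fun u => ?_
      · exact (continuous_mul' Γ).comp (continuous_const.prodMk continuous_id)
      · change mk Γ 1 * mk Γ u = mk Γ u
        rw [← mk_mul, one_mul])
    (fun a => by
      refine UniformSpace.Completion.induction_on (α := ScaledFreeGroup Γ)
        (p := fun a : CompletedFreeGroup Γ => a⁻¹ * a = 1) a (isClosed_eq ?_ continuous_const)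
        fun u => ?_
      · exact (continuous_mul' Γ).comp ((continuous_inv' Γ).prodMk continuous_id)
      · change (mk Γ u)⁻¹ * mk Γ u = mk Γ 1
        rw [← mk_inv, ← mk_mul, inv_mul_cancel])

instance : IsTopologicalGroup (CompletedFreeGroup Γ) where
  continuous_mul := continuous_mul' Γ
  continuous_inv := continuous_inv' Γ

/-- The canonical homomorphism `F(X) → F̄_Γ(X)`. -/
noncomputable def ofFree : FreeGroup X →* CompletedFreeGroup Γ :=
  MonoidHom.mk' (G := CompletedFreeGroup Γ) (fun u : FreeGroup X => mk Γ u) (mk_mul Γ)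

end CompletedFreeGroup

end Group

section Baire

/-- The Baire space `ω^ω`. -/
def Baire : Type := ℕ → ℕ

/-- The metric `d(x, y) = max {2⁻ⁿ : x n ≠ y n}` (for `x ≠ y`) of the Baire space. -/
noncomputable instance : MetricSpace Baire := PiNat.metricSpaceNatNat

namespace Baire

/-- The map `π_n`, which replaces all entries of `x` from the `n`-th on by `0`. -/
def trunc (n : ℕ) (x : Baire) : Baire := fun m => if m < n then x m else 0

/-- The set `𝓝_n` of the points of the Baire space whose entries vanish from the `n`-th on. -/
def level (n : ℕ) : Set Baire := {x | ∀ m, n ≤ m → x m = 0}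

/-- `π_n` as a map onto `𝓝_n`. -/
def proj (n : ℕ) (x : Baire) : level n :=
  ⟨trunc n x, fun _ hm => if_neg (not_lt.2 hm)⟩

end Baire

/-- A scale on the alphabet of the Baire space is regular if `Γ(π_n(x), r) ≤ Γ(x, r)`
for all letters `x`. -/
def Scale.IsRegular (Γ : Scale Baire) : Prop :=
  ∀ (x : Letter Baire) (r : ℝ≥0) (n : ℕ), Γ.toFun (x.map (Baire.trunc n)) r ≤ Γ.toFun x r

/-- The free group `F(𝓝_n)`. -/
def LevelGroup (_Γ : Scale Baire) (n : ℕ) : Type := FreeGroup (Baire.level n)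

namespace LevelGroup

variable (Γ : Scale Baire) (n : ℕ)

noncomputable instance : Group (LevelGroup Γ n) :=
  inferInstanceAs (Group (FreeGroup (Baire.level n)))

/-- The generator of `F(𝓝_n)` given by a point of `𝓝_n`. -/
def of (x : Baire.level n) : LevelGroup Γ n := FreeGroup.of x

/-- The homomorphism `F(𝓝_n) → F̄_Γ(𝓝)` induced by the inclusion of `𝓝_n` in the Baire space. -/
noncomputable def incl : LevelGroup Γ n →* CompletedFreeGroup Γ :=
  (CompletedFreeGroup.ofFree Γ).comp (FreeGroup.map (Subtype.val : Baire.level n → Baire))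

/-- `F(𝓝_n)` carries the topology that it inherits from `F̄_Γ(𝓝)`. -/
noncomputable instance : TopologicalSpace (LevelGroup Γ n) :=
  TopologicalSpace.induced (incl Γ n) inferInstance

end LevelGroup

end Baire

end GraevScale

/-! ### Words under a map of alphabets -/

namespace GraevScale

/-! Two properties of `π_n` carry the proof.

It identifies points closer than `2⁻ⁿ`. As `Γ(x, r) ≥ r`, a matched word of value less than `2⁻ⁿ`
has all its matched letters closer than `2⁻ⁿ`, and its unmatched letters are `e`; so after applying
`π_n` it cancels from the inside out (`MatchVal.map_wordVal_eq_one`). Hence `F(𝓝) → F(𝓝_n)` is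
constant on balls of the fixed radius `2⁻ⁿ`. Because it is a retraction for the inclusion of
`F(𝓝_n)`, that group is discrete; because the radius is uniform, the map extends continuously to the
completion, and the extension is `f_n`.

It also increases neither distances nor, by regularity, the scale. So it does not increase `N_Γ`
(`scaleNorm_map_le`), and `f_n` followed by the inclusion of `F(𝓝_n)` is 1-Lipschitz on the
completion. On the dense subgroup `F(𝓝)` these endomorphisms converge pointwise to the identity,
since `π_n(x) → x` and the group operations are continuous; equicontinuity carries this to the
completion (`tendsto_incl_toLevel`). Every `g` is thus the limit of its images `f_n(g)`, which gives
injectivity. -/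

theorem Letter.val_map {X Y : Type*} (f : X → Y) (a : Letter X) :
    (a.map f).val = FreeGroup.map f a.val := by
  cases a <;> simp [Letter.map, Letter.val]

theorem Letter.map_inv {X Y : Type*} (f : X → Y) (a : Letter X) :
    a.inv.map f = (a.map f).inv := by
  cases a <;> rfl

theorem wordVal_map {X Y : Type*} (f : X → Y) (w : List (Letter X)) :
    wordVal (w.map (Letter.map f)) = FreeGroup.map f (wordVal w) := by
  induction w with
  | nil => simp [wordVal]
  | cons a w ih => rw [List.map_cons, wordVal_cons, wordVal_cons, ih, Letter.val_map, map_mul]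

/-! ### Norm estimates under maps of the underlying space -/

section Nonexpansive

variable {X : Type*} [MetricSpace X]

theorem Letter.d_map_le {f : X → X} (hf : ∀ x y, nndist (f x) (f y) ≤ nndist x y)
    (a b : Letter X) : Letter.d (a.map f) (b.map f) ≤ Letter.d a b := by
  cases a <;> cases b <;> simp [Letter.map, Letter.d, hf]

/-- The image word is built by the same rules in the same order. Each rule is monotone in the letter
distances, the scale values and the value of the inner word, so no stage can increase. -/
theorem MatchVal.exists_map_le {Γ : Scale X} {f : X → X}
    (hf : ∀ x y, nndist (f x) (f y) ≤ nndist x y)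
    (hΓ : ∀ (x : Letter X) (r : ℝ≥0), Γ.toFun (x.map f) r ≤ Γ.toFun x r)
    {w : List (Letter X)} {r : ℝ≥0} (h : MatchVal Γ w r) :
    ∃ s ≤ r, MatchVal Γ (w.map (Letter.map f)) s := by
  induction h with
  | nil => exact ⟨0, le_rfl, .nil⟩
  | single x => exact ⟨_, Letter.d_map_le hf Letter.e x, .single _⟩
  | append _ _ ihu ihv =>
    obtain ⟨s, hs, hu⟩ := ihu
    obtain ⟨t, ht, hv⟩ := ihv
    exact ⟨s + t, add_le_add hs ht, by rw [List.map_append]; exact hu.append hv⟩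
  | wrap x y _ ih =>
    obtain ⟨s, hs, hu⟩ := ih
    refine ⟨_, ?_, by simpa [Letter.map_inv] using MatchVal.wrap (x.map f) (y.map f) hu⟩
    exact add_le_add (Letter.d_map_le hf x y) (max_le_max
      ((hΓ x s).trans (Γ.mono x hs)) ((hΓ y s).trans (Γ.mono y hs)))

/-- A nonexpansive self-map that does not increase the scale induces a nonexpansive
endomorphism of the free group. -/
theorem scaleNorm_map_le {Γ : Scale X} {f : X → X}
    (hf : ∀ x y, nndist (f x) (f y) ≤ nndist x y)
    (hΓ : ∀ (x : Letter X) (r : ℝ≥0), Γ.toFun (x.map f) r ≤ Γ.toFun x r) (u : FreeGroup X) :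
    scaleNorm Γ (FreeGroup.map f u) ≤ scaleNorm Γ u := by
  refine le_of_forall_gt fun c hc => ?_
  obtain ⟨w, r, rfl, hw, hr⟩ := exists_matchVal_lt Γ u hc
  obtain ⟨s, hs, h⟩ := hw.exists_map_le hf hΓ
  rw [← wordVal_map]
  exact (scaleNorm_le Γ h).trans_lt (hs.trans_lt hr)

/-- Match the two letters of the word `a⁻¹ b` with each other: the inner word is empty, and `Γ(·, 0)
= 0`. -/
theorem scaleNorm_inv_mul_le (Γ : Scale X) (a b : Letter X) :
    scaleNorm Γ (a.val⁻¹ * b.val) ≤ Letter.d a b := by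
  have h := scaleNorm_le Γ (MatchVal.wrap a b .nil)
  rw [(Γ.map_eq_zero_iff a 0).2 rfl, (Γ.map_eq_zero_iff b 0).2 rfl, max_self, add_zero] at h
  simpa [wordVal, Letter.val_inv] using h

theorem dist_ofFree (Γ : Scale X) (u v : FreeGroup X) :
    dist (CompletedFreeGroup.ofFree Γ u) (CompletedFreeGroup.ofFree Γ v) =
      (scaleNorm Γ (u * v⁻¹) : ℝ) + scaleNorm Γ (u⁻¹ * v) :=
  ((CompletedFreeGroup.isometry_mk Γ).dist_eq _ _).trans (ScaledFreeGroup.dist_def Γ u v)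

theorem dist_ofFree_of_le (Γ : Scale X) (x y : X) :
    dist (CompletedFreeGroup.ofFree Γ (FreeGroup.of x))
      (CompletedFreeGroup.ofFree Γ (FreeGroup.of y)) ≤ 2 * dist x y := by
  -- The two summands of `d_Γ` are the norms of `x y⁻¹` and `x⁻¹ y`. Negative letters handle the
  -- first and positive letters the second, whence the factor 2.
  have h1 := scaleNorm_inv_mul_le Γ (.neg x) (.neg y)
  have h2 := scaleNorm_inv_mul_le Γ (.pos x) (.pos y)
  simp only [Letter.val, Letter.d, _root_.inv_inv, ← NNReal.coe_le_coe, coe_nndist] at h1 h2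
  rw [dist_ofFree]
  exact (add_le_add h1 h2).trans_eq (two_mul _).symm

/-- A map that identifies points at distance less than `ε ≤ 1` kills the elements of norm
less than `ε`. -/
theorem MatchVal.map_wordVal_eq_one {Y : Type*} {Γ : Scale X} {f : X → Y} {ε : ℝ≥0} (hε : ε ≤ 1)
    (hf : ∀ x y, nndist x y < ε → f x = f y) {w : List (Letter X)} {r : ℝ≥0}
    (h : MatchVal Γ w r) (hr : r < ε) : FreeGroup.map f (wordVal w) = 1 := by
  -- Letters of different kinds are at distance `1 ≥ ε`, so a small distance forces two copies of
  -- `e` or two letters of the same sign with close base points.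
  have key : ∀ a b : Letter X, Letter.d a b < ε →
      FreeGroup.map f a.val = FreeGroup.map f b.val := by
    intro a b hab
    cases a <;> cases b <;>
      first
      | rfl
      | exact absurd hab (not_lt.2 hε)
      | simp [Letter.val, hf _ _ hab]
  induction h with
  | nil => simp [wordVal]
  | single x => simpa [wordVal, Letter.val] using (key _ _ hr).symm
  | append _ _ ihu ihv =>
    rw [wordVal_append, map_mul, ihu (le_self_add.trans_lt hr), ihv (le_add_self.trans_lt hr),
      one_mul]
  | @wrap x y u s _ ih =>
    have h1 := key x y (le_self_add.trans_lt hr)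
    -- Here `s ≤ Γ(x, s)` is what makes smallness descend to the inner word.
    have h2 := ih (((Γ.le_map x s).trans ((le_max_left _ _).trans le_add_self)).trans_lt hr)
    rw [wordVal_cons, wordVal_append, map_mul, map_mul, h2, Letter.val_inv, map_inv, h1]
    simp [wordVal]

theorem map_eq_one_of_scaleNorm_lt {Y : Type*} (Γ : Scale X) {f : X → Y} {ε : ℝ≥0} (hε : ε ≤ 1)
    (hf : ∀ x y, nndist x y < ε → f x = f y) {u : FreeGroup X} (hu : scaleNorm Γ u < ε) :
    FreeGroup.map f u = 1 := by
  obtain ⟨w, r, rfl, hw, hr⟩ := exists_matchVal_lt Γ u hu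
  exact hw.map_wordVal_eq_one hε hf hr

/-- The norm of `u⁻¹ v` is one of the two summands of the distance, so it is below `ε` and `u⁻¹ v`
is killed. -/
theorem map_eq_of_dist_lt {Y : Type*} (Γ : Scale X) {f : X → Y} {ε : ℝ≥0} (hε : ε ≤ 1)
    (hf : ∀ x y, nndist x y < ε → f x = f y) {u v : FreeGroup X}
    (h : dist (CompletedFreeGroup.ofFree Γ u) (CompletedFreeGroup.ofFree Γ v) < ε) :
    FreeGroup.map f u = FreeGroup.map f v := by
  rw [dist_ofFree] at h
  have h1 : scaleNorm Γ (u⁻¹ * v) < ε := by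
    exact_mod_cast (le_add_of_nonneg_left (NNReal.coe_nonneg _)).trans_lt h
  have h2 := map_eq_one_of_scaleNorm_lt Γ hε hf h1
  rw [map_mul, map_inv] at h2
  exact inv_mul_eq_one.1 h2

end Nonexpansive

/-! ### Truncation in the Baire space -/

namespace Baire

theorem trunc_eq_of_dist_lt {n : ℕ} {x y : Baire} (h : dist x y < (1 / 2) ^ n) :
    trunc n x = trunc n y := by
  funext m
  simp only [trunc]
  split_ifs with hm
  · exact PiNat.apply_eq_of_dist_lt (E := fun _ => ℕ) h hm.le
  · rfl

theorem dist_trunc_le (n : ℕ) (x : Baire) : dist (trunc n x) x ≤ (1 / 2) ^ n :=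
  (PiNat.mem_cylinder_iff_dist_le (E := fun _ => ℕ)).1 fun _ hi => if_pos hi

/-- Truncations agree at least as far as the original sequences do. -/
theorem nndist_trunc_le (n : ℕ) (x y : Baire) :
    nndist (trunc n x) (trunc n y) ≤ nndist x y := by
  rw [← NNReal.coe_le_coe, coe_nndist, coe_nndist]
  by_cases hxy : x = y
  · simp [hxy]
  have hd : dist x y = (1 / 2) ^ PiNat.firstDiff x y :=
    PiNat.dist_eq_of_ne (E := fun _ => ℕ) hxy
  rw [hd]
  refine (PiNat.mem_cylinder_iff_dist_le (E := fun _ => ℕ)).1 fun i hi => ?_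
  simp only [trunc]
  rw [PiNat.apply_eq_of_lt_firstDiff (E := fun _ => ℕ) hi]

theorem tendsto_trunc (x : Baire) : Tendsto (fun n => trunc n x) atTop (𝓝 x) :=
  tendsto_iff_dist_tendsto_zero.2 (squeeze_zero (fun _ => dist_nonneg)
    (fun n => dist_trunc_le n x)
    (tendsto_pow_atTop_nhds_zero_of_lt_one (by norm_num) (by norm_num)))

theorem proj_eq_of_nndist_lt (n : ℕ) (x y : Baire) (h : nndist x y < (1 / 2) ^ n) :
    proj n x = proj n y :=
  Subtype.ext (trunc_eq_of_dist_lt (by exact_mod_cast h))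

theorem proj_coe {n : ℕ} (x : level n) : proj n x = x := by
  refine Subtype.ext (funext fun m => ?_)
  change (if m < n then x.1 m else 0) = x.1 m
  split_ifs with hm
  · rfl
  · exact (x.2 m (not_lt.1 hm)).symm

end Baire

/-! ### Discreteness of the level groups -/

variable (Γ : Scale Baire) (n : ℕ)

/-- The homomorphism `F(𝓝) → F(𝓝_n)` induced by `π_n`. -/
noncomputable def levelMap : FreeGroup Baire →* LevelGroup Γ n :=
  FreeGroup.map (Baire.proj n)

/-- The radius does not depend on `u`. This uniformity yields both the discreteness of `F(𝓝_n)` and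
the extension to the completion. -/
theorem levelMap_eq_of_dist_lt {u v : FreeGroup Baire}
    (h : dist (CompletedFreeGroup.ofFree Γ u) (CompletedFreeGroup.ofFree Γ v) < (1 / 2) ^ n) :
    levelMap Γ n u = levelMap Γ n v :=
  map_eq_of_dist_lt Γ (ε := (1 / 2) ^ n) (pow_le_one₀ zero_le (by norm_num))
    (Baire.proj_eq_of_nndist_lt n) (by exact_mod_cast h)

theorem levelMap_map_coe (v : LevelGroup Γ n) :
    levelMap Γ n (FreeGroup.map (Subtype.val : Baire.level n → Baire) v) = v := by
  refine (FreeGroup.map.comp (x := v) Subtype.val (Baire.proj n)).trans ?_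
  rw [show Baire.proj n ∘ Subtype.val = id from funext Baire.proj_coe]
  exact FreeGroup.map.id v

instance LevelGroup.discreteTopology : DiscreteTopology (LevelGroup Γ n) := by
  refine discreteTopology_iff_isOpen_singleton.2 fun v => ?_
  -- Two elements of `F(𝓝_n)` with inclusions this close have the same image under the retraction,
  -- hence are equal.
  refine isOpen_induced_iff.2 ⟨Metric.ball (LevelGroup.incl Γ n v) ((1 / 2) ^ n),
    Metric.isOpen_ball, Set.ext fun u => ⟨fun hu => ?_, ?_⟩⟩
  · have h := levelMap_eq_of_dist_lt Γ n (Metric.mem_ball.1 hu)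
    exact (levelMap_map_coe Γ n u).symm.trans (h.trans (levelMap_map_coe Γ n v))
  · rintro rfl
    exact Metric.mem_ball_self (by positivity)

/-- The trace on `F(𝓝)` of the neighbourhoods of `a` is a Cauchy filter. One of its members has all
mutual distances below `2⁻ⁿ`, so the map is constant there and its value is the limit. -/
theorem tendsto_levelMap (a : CompletedFreeGroup Γ) :
    ∃ c, Tendsto (fun u : ScaledFreeGroup Γ => levelMap Γ n u)
      (comap (CompletedFreeGroup.mk Γ) (𝓝 a)) (𝓝 c) := by
  have hc : Cauchy (comap (CompletedFreeGroup.mk Γ) (𝓝 a)) :=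
    cauchy_nhds.comap' (CompletedFreeGroup.isometry_mk Γ).isUniformInducing.comap_uniformity.le
      ((CompletedFreeGroup.isDenseInducing_mk Γ).comap_nhds_neBot a)
  have := hc.1
  obtain ⟨S, hS, hd⟩ := (Metric.cauchy_iff.1 hc).2 ((1 / 2) ^ n) (by positivity)
  obtain ⟨v, hv⟩ := Filter.nonempty_of_mem hS
  refine ⟨levelMap Γ n v, tendsto_const_nhds.congr' ?_⟩
  filter_upwards [hS] with u hu
  exact levelMap_eq_of_dist_lt Γ n
    (((CompletedFreeGroup.isometry_mk Γ).dist_eq v u).trans_lt (hd v hv u hu))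

/-! ### The homomorphisms from the completion -/

namespace CompletedFreeGroup

/-- The continuous extension of `levelMap` to the completion. -/
noncomputable def levelExtend : CompletedFreeGroup Γ → LevelGroup Γ n :=
  (isDenseInducing_mk Γ).extend fun u : ScaledFreeGroup Γ => levelMap Γ n u

theorem continuous_levelExtend : Continuous (levelExtend Γ n) :=
  (isDenseInducing_mk Γ).continuous_extend (tendsto_levelMap Γ n)

theorem levelExtend_mk (u : ScaledFreeGroup Γ) : levelExtend Γ n (mk Γ u) = levelMap Γ n u :=
  (isDenseInducing_mk Γ).extend_eq' (tendsto_levelMap Γ n) u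

/-- The homomorphism `f_n : F̄_Γ(𝓝) → F(𝓝_n)` extending `π_n`. -/
noncomputable def toLevel : CompletedFreeGroup Γ →* LevelGroup Γ n :=
  MonoidHom.mk' (levelExtend Γ n) fun a b => by
    have hf := continuous_levelExtend Γ n
    -- Multiplicativity is a closed condition because `F(𝓝_n)`, being discrete, is Hausdorff with
    -- continuous multiplication. It therefore suffices to check it on the dense subgroup.
    refine UniformSpace.Completion.induction_on₂ (α := ScaledFreeGroup Γ)
      (β := ScaledFreeGroup Γ)
      (p := fun a b : CompletedFreeGroup Γ =>
        levelExtend Γ n (a * b) = levelExtend Γ n a * levelExtend Γ n b) a b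
      (isClosed_eq (hf.comp (continuous_mul' Γ))
        ((hf.comp continuous_fst).mul (hf.comp continuous_snd))) fun u v => ?_
    change levelExtend Γ n (mk Γ u * mk Γ v) = levelExtend Γ n (mk Γ u) * levelExtend Γ n (mk Γ v)
    rw [← mk_mul, levelExtend_mk, levelExtend_mk, levelExtend_mk]
    exact map_mul (levelMap Γ n) u v

theorem toLevel_ofFree (u : FreeGroup Baire) : toLevel Γ n (ofFree Γ u) = levelMap Γ n u :=
  levelExtend_mk Γ n u

theorem toLevel_incl (v : LevelGroup Γ n) : toLevel Γ n (LevelGroup.incl Γ n v) = v :=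
  (toLevel_ofFree Γ n _).trans (levelMap_map_coe Γ n v)

theorem incl_levelMap (u : FreeGroup Baire) :
    LevelGroup.incl Γ n (levelMap Γ n u) = ofFree Γ (FreeGroup.map (Baire.trunc n) u) := by
  change ofFree Γ (FreeGroup.map Subtype.val (FreeGroup.map (Baire.proj n) u)) = _
  rw [FreeGroup.map.comp]
  rfl

/-- True on generators because `x ↦ x` from the Baire space to the completion is 2-Lipschitz; the
continuous group operations propagate it to all words. -/
theorem tendsto_ofFree_map_trunc (u : FreeGroup Baire) :
    Tendsto (fun n => ofFree Γ (FreeGroup.map (Baire.trunc n) u)) atTop (𝓝 (ofFree Γ u)) := by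
  have hof : ∀ x : Baire, Tendsto (fun n => ofFree Γ (FreeGroup.map (Baire.trunc n)
      (FreeGroup.of x))) atTop (𝓝 (ofFree Γ (FreeGroup.of x))) := fun x => by
    simp only [FreeGroup.map.of]
    refine tendsto_iff_dist_tendsto_zero.2 (squeeze_zero (fun _ => dist_nonneg)
      (fun n => dist_ofFree_of_le Γ _ x) ?_)
    simpa using (tendsto_iff_dist_tendsto_zero.1 (Baire.tendsto_trunc x)).const_mul 2
  induction u using FreeGroup.induction_on with
  | C1 => simp
  | of x => exact hof x
  | inv_of x _ => simpa only [map_inv] using (hof x).inv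
  | mul a b ha hb => simpa only [map_mul] using ha.mul hb

/-! ### Regularity and convergence to the identity -/

variable {Γ}

theorem dist_ofFree_map_trunc_le (hreg : Γ.IsRegular) (u v : FreeGroup Baire) :
    dist (ofFree Γ (FreeGroup.map (Baire.trunc n) u))
      (ofFree Γ (FreeGroup.map (Baire.trunc n) v)) ≤ dist (ofFree Γ u) (ofFree Γ v) := by
  rw [dist_ofFree, dist_ofFree]
  have key := fun w : FreeGroup Baire =>
    scaleNorm_map_le (Baire.nndist_trunc_le n) (fun x r => hreg x r n) w
  have h1 := key (u * v⁻¹)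
  have h2 := key (u⁻¹ * v)
  rw [map_mul, map_inv] at h1 h2
  exact_mod_cast add_le_add h1 h2

/-- Both sides are continuous in `(a, b)`, so the bound passes from `F(𝓝)` to its completion. Being
uniform in `n`, it gives the equicontinuity needed for pointwise convergence. -/
theorem dist_incl_toLevel_le (hreg : Γ.IsRegular) (a b : CompletedFreeGroup Γ) :
    dist (LevelGroup.incl Γ n (toLevel Γ n a)) (LevelGroup.incl Γ n (toLevel Γ n b)) ≤
      dist a b := by
  have hf : Continuous fun a => LevelGroup.incl Γ n (toLevel Γ n a) :=
    continuous_induced_dom.comp (continuous_levelExtend Γ n)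
  refine UniformSpace.Completion.induction_on₂ (α := ScaledFreeGroup Γ)
    (β := ScaledFreeGroup Γ)
    (p := fun a b : CompletedFreeGroup Γ => dist (LevelGroup.incl Γ n (toLevel Γ n a))
      (LevelGroup.incl Γ n (toLevel Γ n b)) ≤ dist a b) a b
    (isClosed_le ((hf.comp continuous_fst).dist (hf.comp continuous_snd))
      (continuous_dist (α := CompletedFreeGroup Γ))) fun (u v : FreeGroup Baire) => ?_
  change dist (LevelGroup.incl Γ n (toLevel Γ n (ofFree Γ u)))
    (LevelGroup.incl Γ n (toLevel Γ n (ofFree Γ v))) ≤ dist (ofFree Γ u) (ofFree Γ v)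
  rw [toLevel_ofFree, toLevel_ofFree, incl_levelMap, incl_levelMap]
  exact dist_ofFree_map_trunc_le n hreg u v

/-- For a regular scale the homomorphisms `f_n` converge pointwise to the identity. -/
theorem tendsto_incl_toLevel (hreg : Γ.IsRegular) (a : CompletedFreeGroup Γ) :
    Tendsto (fun n => LevelGroup.incl Γ n (toLevel Γ n a)) atTop (𝓝 a) := by
  refine Metric.tendsto_atTop.2 fun ε hε => ?_
  -- Three thirds of `ε`: the images of `a` and `u`, the image of `u` and `u` itself, then `u` and
  -- `a`.
  obtain ⟨u, hu⟩ : ∃ u : FreeGroup Baire, dist a (ofFree Γ u) < ε / 3 := by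
    obtain ⟨_, h, u, rfl⟩ := Metric.dense_iff.1 (isDenseInducing_mk Γ).dense a (ε / 3)
      (by positivity)
    exact ⟨u, by rw [dist_comm]; exact h⟩
  obtain ⟨k, hk⟩ := Metric.tendsto_atTop.1 (tendsto_ofFree_map_trunc Γ u) (ε / 3) (by positivity)
  refine ⟨k, fun n hn => ?_⟩
  have h1 := hk n hn
  have h2 := dist_incl_toLevel_le n hreg a (ofFree Γ u)
  rw [toLevel_ofFree, incl_levelMap] at h2
  have h3 := dist_triangle4 (LevelGroup.incl Γ n (toLevel Γ n a))
    (ofFree Γ (FreeGroup.map (Baire.trunc n) u)) (ofFree Γ u) a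
  rw [dist_comm] at hu
  rw [dist_comm a] at h2
  linarith

end CompletedFreeGroup

end GraevScale

theorem theorem3p5 (Γ : GraevScale.Scale GraevScale.Baire) (hreg : Γ.IsRegular)
    (hcont : ∀ x : GraevScale.Letter GraevScale.Baire, Continuous (Γ.toFun x)) :
    (∀ n : ℕ, DiscreteTopology (GraevScale.LevelGroup Γ n)) ∧
    ∃ f : ∀ n : ℕ, GraevScale.CompletedFreeGroup Γ →* GraevScale.LevelGroup Γ n,
      (∀ n : ℕ, Continuous (f n) ∧ Function.Surjective (f n) ∧
        ∀ x : GraevScale.Baire,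
          f n (GraevScale.CompletedFreeGroup.ofFree Γ (FreeGroup.of x)) =
            GraevScale.LevelGroup.of Γ n (GraevScale.Baire.proj n x)) ∧
      Continuous (MonoidHom.pi f) ∧ Function.Injective (MonoidHom.pi f) := by
  have hf : ∀ n, Continuous (GraevScale.CompletedFreeGroup.toLevel Γ n) :=
    GraevScale.CompletedFreeGroup.continuous_levelExtend Γ
  refine ⟨fun n => inferInstance, GraevScale.CompletedFreeGroup.toLevel Γ, fun n =>
    ⟨hf n, fun v => ⟨_, GraevScale.CompletedFreeGroup.toLevel_incl Γ n v⟩, fun x => ?_⟩,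
    continuous_pi hf, fun a b hab => ?_⟩
  · exact (GraevScale.CompletedFreeGroup.toLevel_ofFree Γ n _).trans FreeGroup.map.of
  -- Equal images at every level make `a` and `b` limits of one and the same sequence.
  · have h := GraevScale.CompletedFreeGroup.tendsto_incl_toLevel hreg a
    have hab' : ∀ n, GraevScale.CompletedFreeGroup.toLevel Γ n a =
        GraevScale.CompletedFreeGroup.toLevel Γ n b := fun n => congrFun hab n
    simp only [hab'] at h
    exact tendsto_nhds_unique h (GraevScale.CompletedFreeGroup.tendsto_incl_toLevel hreg b)
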